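/- Let $q$ be a prime power, let $n\le m$ be positive integers, and let $\mathcal C\subseteq\mathbb F_{q^m}^n$ be a nonzero $\mathbb F_{q^m}$-linear code of dimension $k<n$. The rank distance of $v,w\in\mathbb F_{q^m}^n$ is $\dim_{\mathbb F_q}\langle v_1-w_1,\dots,v_n-w_n\rangle_{\mathbb F_q}$. Assume that $\mathcal C$ is an MRD code, i.e. its minimum rank distance $d$ satisfies $k=n-d+1$. We call $\mathcal C$ a Gabidulin code if there are $\alpha_1,\dots,\alpha_n\in\mathbb F_{q^m}$, linearly independent over $\mathbb F_q$, such that the $k\times n$ matrix $\big(\alpha_j^{q^{i}}\big)_{0\le i<k,\,1\le j\le n}$ is a generator matrix of $\mathcal C$. Let $G$ be a generator matrix of $\mathcal C$, let $\mathcal U$ be the $\mathbb F_q$-span of its columns in $\mathbb F_{q^m}^k$, and let $\mathcal C^{\mathrm H}$ be the $\mathbb F_{q^m}$-linear code spanned by the rows of a matrix whose columns form a set of representatives of the nonzero vectors of $\mathcal U$ up to multiplication by elements of $\mathbb F_q^*$. Put $h_i(\mathcal C)=\dim_{\mathbb F_{q^m}}(\mathcal C^{\mathrm H})^{(i)}$,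 where $(\mathcal C^{\mathrm H})^{(i)}$ is the $i$-th Schur power of $\mathcal C^{\mathrm H}$ (the span of all componentwise products of $i$ codewords); this number does not depend on the choices made. Consider the equality $$h_{q+1}(\mathcal C)=\binom{k+q}{q+1}-\binom{k-1}{2}.\qquad(\ast)$$ Then: 1. if $\mathcal C$ is a Gabidulin code, then $(\ast)$ holds; 2. if $k\neq 2$, or if $k=2$ and $n=3$, then $\mathcal C$ is a Gabidulin code if and only if $(\ast)$ holds. -/

import Mathlib

open scoped LinearAlgebra.Projectivization

namespace RankMetric

variable (F : Type*) {K : Type*} [Field F] [Field K] [Algebra F K] {n k : ℕ}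

/-- The rank distance over `K / F`: the `F`-dimension of the `F`-span of the entries of `v - w`. -/
noncomputable def rankDist (v w : Fin n → K) : ℕ :=
  Module.finrank F (Submodule.span F (Set.range (v - w)))

/-- The minimum rank distance of a (nonzero) linear code. -/
noncomputable def minRankDist (C : Submodule K (Fin n → K)) : ℕ :=
  sInf {d | ∃ v ∈ C, ∃ w ∈ C, v ≠ w ∧ rankDist F v w = d}

/-- A nonzero linear rank-metric code of length `n` (at most the degree of `K / F`) is maximum rank
distance when it attains the bound `dim C ≤ n - d + 1`, where `d` is its minimum rank distance. -/
def IsMRD (C : Submodule K (Fin n → K)) : Prop :=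
  C ≠ ⊥ ∧ n ≤ Module.finrank F K ∧ Module.finrank K C + minRankDist F C = n + 1

/-- A generator matrix of `C`: its rows form a basis of `C`. -/
def IsGeneratorMatrix (G : Matrix (Fin k) (Fin n) K) (C : Submodule K (Fin n → K)) : Prop :=
  LinearIndependent K G.row ∧ Submodule.span K (Set.range G.row) = C

/-- The `k × n` matrix with `(i, j)` entry `α_j ^ (q ^ (s i))`, where `q` is the order of `F`. -/
noncomputable def mooreMatrix (s k : ℕ) (α : Fin n → K) : Matrix (Fin k) (Fin n) K :=
  Matrix.of fun i j => α j ^ (Nat.card F ^ (s * (i : ℕ)))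

/-- `C` is a generalized Gabidulin code of dimension `k` with parameter `s`. -/
def IsGeneralizedGabidulin (s k : ℕ) (C : Submodule K (Fin n → K)) : Prop :=
  Nat.gcd s (Module.finrank F K) = 1 ∧
    ∃ α : Fin n → K, LinearIndependent F α ∧ IsGeneratorMatrix (mooreMatrix F s k α) C

/-- `C` is a Gabidulin code, of some dimension `k` (necessarily the dimension of `C`). -/
def IsGabidulin (C : Submodule K (Fin n → K)) : Prop :=
  ∃ k : ℕ, IsGeneralizedGabidulin F 1 k C

/-- The `F`-span of the columns of `G`. -/
def system (G : Matrix (Fin k) (Fin n) K) : Submodule F (Fin k → K) :=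
  Submodule.span F (Set.range G.col)

/-- The columns of `H` form a set of representatives of the nonzero vectors of `U` modulo
proportionality over `F`. -/
def IsExtendedMatrix (U : Submodule F (Fin k → K)) {ι : Type*} (H : Matrix (Fin k) ι K) : Prop :=
  (∀ j, H.col j ∈ U ∧ H.col j ≠ 0) ∧
    ∀ u ∈ U, u ≠ 0 → ∃! j, ∃ a : F, a ≠ 0 ∧ u = a • H.col j

/-- An extended matrix of `G`: the columns are indexed by the classes of nonzero vectors of the
system of `G` modulo proportionality over `F`, and each column represents its class. -/
noncomputable def extendedMatrix (G : Matrix (Fin k) (Fin n) K) :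
    Matrix (Fin k) (ℙ F (system F G)) K :=
  Matrix.of fun i p => (p.rep : Fin k → K) i

/-- The Hamming-metric code generated by the rows of `H`. -/
def hammingCode {ι : Type*} (H : Matrix (Fin k) ι K) : Submodule K (ι → K) :=
  Submodule.span K (Set.range H.row)

/-- The matrix whose rows are the vectors of a chosen basis of `C`. -/
noncomputable def generatorMatrix (C : Submodule K (Fin n → K)) :
    Matrix (Fin (Module.finrank K C)) (Fin n) K :=
  Matrix.of fun i => (Module.finBasis K C i : Fin n → K)

/-- The `F`-dimension sequence (`F`-Hilbert sequence) `h_i(C)`: the dimension of the `i`-th Schur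
power of the Hamming-metric code associated to `C`. The product of two submodules of the algebra
`ι → K`, whose multiplication is componentwise, is the span of the products of their elements, so
that the power below is the Schur power (and the power with exponent `0` is the span of the
all-one vector). The value does not depend on the choices made, see `hilbertSeq_eq`. -/
noncomputable def hilbertSeq (C : Submodule K (Fin n → K)) (i : ℕ) : ℕ :=
  Module.finrank K ↥(hammingCode (extendedMatrix F (generatorMatrix C)) ^ i)

theorem isGeneratorMatrix_generatorMatrix (C : Submodule K (Fin n → K)) :
    IsGeneratorMatrix (generatorMatrix C) C := by
  constructor
  · exact (Module.finBasis K C).linearIndependent.map' C.subtype (by simp)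
  · have h : Set.range (generatorMatrix C).row = C.subtype '' Set.range (Module.finBasis K C) := by
      ext x
      simp only [Set.mem_range, Set.mem_image, exists_exists_eq_and]
      rfl
    rw [h, Submodule.span_image, (Module.finBasis K C).span_eq]
    simp

theorem isExtendedMatrix_extendedMatrix (G : Matrix (Fin k) (Fin n) K) :
    IsExtendedMatrix F (system F G) (extendedMatrix F G) := by
  have hc : ∀ p, (extendedMatrix F G).col p = (p.rep : Fin k → K) := fun p => rfl
  refine ⟨fun p => ?_, fun u hu hu0 => ?_⟩
  · rw [hc]
    exact ⟨p.rep.2, fun h => p.rep_nonzero (Subtype.ext h)⟩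
  · have hv : (⟨u, hu⟩ : system F G) ≠ 0 := fun h => hu0 (congrArg Subtype.val h)
    refine ⟨Projectivization.mk F ⟨u, hu⟩ hv, ?_, ?_⟩
    · obtain ⟨a, ha⟩ := Projectivization.exists_smul_eq_mk_rep F _ hv
      refine ⟨((a⁻¹ : Fˣ) : F), Units.ne_zero _, ?_⟩
      rw [hc, ← ha]
      change u = (a⁻¹ : Fˣ) • (a • u)
      simp
    · rintro p ⟨a, ha0, ha⟩
      rw [hc] at ha
      rw [← Projectivization.mk_rep p, Projectivization.mk_eq_mk_iff']
      refine ⟨a⁻¹, Subtype.ext ?_⟩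
      change a⁻¹ • u = _
      rw [ha, smul_smul, inv_mul_cancel₀ ha0, one_smul]

theorem finrank_hammingCode_pow_le {k₁ k₂ : ℕ} (G₁ : Matrix (Fin k₁) (Fin n) K)
    (G₂ : Matrix (Fin k₂) (Fin n) K) (A : Matrix (Fin k₂) (Fin k₁) K)
    (B : Matrix (Fin k₁) (Fin k₂) K) (hA : A * G₁ = G₂) (hB : B * G₂ = G₁)
    {ι₁ ι₂ : Type*} (H₁ : Matrix (Fin k₁) ι₁ K) (H₂ : Matrix (Fin k₂) ι₂ K)
    (h₁ : IsExtendedMatrix F (system F G₁) H₁) (h₂ : IsExtendedMatrix F (system F G₂) H₂) (i : ℕ) :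
    Module.finrank K ↥(hammingCode H₂ ^ i) ≤ Module.finrank K ↥(hammingCode H₁ ^ i) := by
  have key : ∀ {a b : ℕ} (G : Matrix (Fin a) (Fin n) K) (A : Matrix (Fin b) (Fin a) K),
      ∀ u ∈ system F G, A.mulVec u ∈ system F (A * G) := by
    intro a b G A u hu
    induction hu using Submodule.span_induction with
    | mem x hx =>
      obtain ⟨j, rfl⟩ := hx
      exact Submodule.subset_span ⟨j, rfl⟩
    | zero => simp
    | add x y _ _ hx hy => rw [Matrix.mulVec_add]; exact add_mem hx hy
    | smul c x _ hx => rw [Matrix.mulVec_smul]; exact Submodule.smul_mem _ _ hx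
  have key2 : ∀ {a : ℕ} (G : Matrix (Fin a) (Fin n) K) (D : Matrix (Fin a) (Fin a) K),
      D * G = G → ∀ u ∈ system F G, D.mulVec u = u := by
    intro a G D hD u hu
    induction hu using Submodule.span_induction with
    | mem x hx =>
      obtain ⟨j, rfl⟩ := hx
      change (D * G).col j = G.col j
      rw [hD]
    | zero => simp
    | add x y _ _ hx hy => rw [Matrix.mulVec_add, hx, hy]
    | smul c x _ hx => rw [Matrix.mulVec_smul, hx]
  have hBA : ∀ u ∈ system F G₁, B.mulVec (A.mulVec u) = u := by
    intro u hu
    rw [Matrix.mulVec_mulVec]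
    exact key2 G₁ _ (by rw [Matrix.mul_assoc, hA, hB]) u hu
  have hAB : ∀ u ∈ system F G₂, A.mulVec (B.mulVec u) = u := by
    intro u hu
    rw [Matrix.mulVec_mulVec]
    exact key2 G₂ _ (by rw [Matrix.mul_assoc, hB, hA]) u hu
  have hex : ∀ j, ∃ j', ∃ a : F, a ≠ 0 ∧ A.mulVec (H₁.col j) = a • H₂.col j' := by
    intro j
    refine (h₂.2 _ (hA ▸ key G₁ A _ (h₁.1 j).1) ?_).exists
    intro h0
    apply (h₁.1 j).2
    rw [← hBA _ (h₁.1 j).1, h0, Matrix.mulVec_zero]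
  choose e c hc0 hc using hex
  have he : Function.Surjective e := by
    intro j'
    have hu : B.mulVec (H₂.col j') ∈ system F G₁ := hB ▸ key G₂ B _ (h₂.1 j').1
    obtain ⟨j, ⟨a, ha0, ha⟩, -⟩ := h₁.2 _ hu (by
      intro h0
      apply (h₂.1 j').2
      rw [← hAB _ (h₂.1 j').1, h0, Matrix.mulVec_zero])
    refine ⟨j, (h₂.2 _ (h₂.1 j').1 (h₂.1 j').2).unique ⟨a * c j, mul_ne_zero ha0 (hc0 j), ?_⟩
      ⟨1, one_ne_zero, (one_smul _ _).symm⟩⟩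
    rw [mul_smul, ← hc, ← Matrix.mulVec_smul, ← ha, hAB _ (h₂.1 j').1]
  let ψ : ℕ → (ι₂ → K) →ₗ[K] (ι₁ → K) := fun i =>
    { toFun := fun x j => algebraMap F K (c j) ^ i * x (e j)
      map_add' := fun x y => by ext j; simp [mul_add]
      map_smul' := fun a x => by ext j; simp [mul_left_comm] }
  have hψ : ∀ i x j, ψ i x j = algebraMap F K (c j) ^ i * x (e j) := fun _ _ _ => rfl
  have hinj : Function.Injective (ψ i) := by
    intro x y hxy
    ext j'
    obtain ⟨j, rfl⟩ := he j'
    have h := congrFun hxy j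
    rw [hψ, hψ] at h
    exact mul_left_cancel₀ (pow_ne_zero _ (by simpa using hc0 j)) h
  have hone : ∀ x ∈ hammingCode H₂, ψ 1 x ∈ hammingCode H₁ := by
    intro x hx
    induction hx using Submodule.span_induction with
    | mem x hx =>
      obtain ⟨b, rfl⟩ := hx
      have h : ψ 1 (H₂.row b) = ∑ l, A b l • H₁.row l := by
        ext j
        have h' := congrFun (hc j) b
        simp only [Matrix.mulVec, dotProduct, Pi.smul_apply, Algebra.smul_def] at h'
        rw [hψ, pow_one, Finset.sum_apply]
        exact h'.symm
      rw [h]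
      exact Submodule.sum_mem _ fun l _ =>
        Submodule.smul_mem _ _ (Submodule.subset_span ⟨l, rfl⟩)
    | zero => simp
    | add x y _ _ hx hy => rw [map_add]; exact add_mem hx hy
    | smul a x _ hx => rw [map_smul]; exact Submodule.smul_mem _ _ hx
  have hpow : ∀ i, ∀ x ∈ hammingCode H₂ ^ i, ψ i x ∈ hammingCode H₁ ^ i := by
    intro i
    induction i with
    | zero =>
      intro x hx
      rw [pow_zero, Submodule.mem_one] at hx ⊢
      obtain ⟨a, rfl⟩ := hx
      exact ⟨a, by ext j; simp [hψ]⟩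
    | succ i ih =>
      intro x hx
      rw [pow_succ] at hx ⊢
      induction hx using Submodule.mul_induction_on' with
      | mem_mul_mem x hx y hy =>
        have h : ψ (i + 1) (x * y) = ψ i x * ψ 1 y := by
          ext j
          simp only [hψ, Pi.mul_apply]
          ring
        rw [h]
        exact Submodule.mul_mem_mul (ih x hx) (hone y hy)
      | add x _ y _ hx hy => rw [map_add]; exact add_mem hx hy
  have hfg : (hammingCode H₁ ^ i).FG :=
    Submodule.FG.pow (Submodule.fg_span (Set.finite_range _)) i
  have : Module.Finite K ↥(hammingCode H₁ ^ i) := Module.Finite.iff_fg.mpr hfg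
  exact LinearMap.finrank_le_finrank_of_injective
    (f := (ψ i).restrict (hpow i)) fun x y hxy =>
      Subtype.ext (hinj (congrArg Subtype.val hxy))

theorem exists_mul_eq {k₁ k₂ : ℕ} (C : Submodule K (Fin n → K)) (G₁ : Matrix (Fin k₁) (Fin n) K)
    (G₂ : Matrix (Fin k₂) (Fin n) K) (h₁ : IsGeneratorMatrix G₁ C) (h₂ : IsGeneratorMatrix G₂ C) :
    ∃ A : Matrix (Fin k₂) (Fin k₁) K, A * G₁ = G₂ := by
  have h : ∀ b, ∃ v : Fin k₁ → K, ∑ l, v l • G₁.row l = G₂.row b := by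
    intro b
    have hb : G₂.row b ∈ Submodule.span K (Set.range G₁.row) := by
      rw [h₁.2, ← h₂.2]
      exact Submodule.subset_span ⟨b, rfl⟩
    exact (Submodule.mem_span_range_iff_exists_fun K).mp hb
  choose A hA using h
  refine ⟨Matrix.of A, ?_⟩
  ext b j
  have hbj := congrFun (hA b) j
  rw [Finset.sum_apply] at hbj
  exact hbj

/-- The sequence can be computed from any generator matrix of `C` and any extended matrix. -/
theorem hilbertSeq_eq (C : Submodule K (Fin n → K)) (G : Matrix (Fin k) (Fin n) K)
    (hG : IsGeneratorMatrix G C) {ι : Type*} (H : Matrix (Fin k) ι K)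
    (hH : IsExtendedMatrix F (system F G) H) (i : ℕ) :
    Module.finrank K ↥(hammingCode H ^ i) = hilbertSeq F C i := by
  obtain ⟨A, hA⟩ := exists_mul_eq C _ _ hG (isGeneratorMatrix_generatorMatrix C)
  obtain ⟨B, hB⟩ := exists_mul_eq C _ _ (isGeneratorMatrix_generatorMatrix C) hG
  have hE := isExtendedMatrix_extendedMatrix F (generatorMatrix C)
  exact le_antisymm (finrank_hammingCode_pow_le F _ _ B A hB hA _ _ hE hH i)
    (finrank_hammingCode_pow_le F _ _ A B hA hB _ _ hH hE i)

end RankMetric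

namespace RankMetric

open MvPolynomial Matrix

/-! ### Forms of degree `q + 1` and alternating matrices. -/

section Forms

variable {K : Type*} [Field K] {k : ℕ}

/-! By the MRD property, `C` has a systematic generator matrix `G`. The `(q+1)`-st Schur power is
the image of the forms of degree `q + 1` under evaluation on the system `U` of `G`, so its
codimension in all such forms counts the forms vanishing on `U`. As `U` contains `F^k`, these forms
have the shape `∑ M i j X_i^q X_j` with `M` alternating (`exists_eq_twistedForm`), and such a form
vanishes on `U` iff `M` kills every column of `G^(q) - G`, with the Frobenius taken entrywise
(`forall_eval_twistedForm_eq_zero_iff`).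

The matrix `G^(q) - G` is nonzero, so the alternating matrices killing its columns have dimension at
most `(k-1).choose 2`. Rank one gives equality, and for `k > 2` equality forces rank one
(`not_altForms_le_of_two_lt`). For `k = 1`, or `k = 2` and `n = 3`, rank one is automatic.

Finally, rank one characterizes Gabidulin codes. Frobenius shifts the rows of a Moore matrix and
only the last leaves the code (`IsGabidulin.exists_pow_sub_eq_mul`). Conversely, if `G^(q) - G = t
γᵀ`, take `c ≠ 0` whose Frobenius powers of index `1, …, k-1` are orthogonal to `t`; then `α = cG`
generates the code (`IsMRD.isGabidulin_of_pow_sub_eq_mul`). -/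

theorem finrank_homogeneousSubmodule (k d : ℕ) :
    Module.finrank K (homogeneousSubmodule (Fin k) K d) = (k + d - 1).choose d := by
  classical
  have hspan : homogeneousSubmodule (Fin k) K d = Submodule.span K (Set.range
      fun e : (Finset.univ : Finset (Fin k)).finsuppAntidiag d =>
        (monomial (e : Fin k →₀ ℕ) (1 : K))) := by
    rw [homogeneousSubmodule_eq_finsupp_supported, AddMonoidAlgebra.supported_eq_span_single]
    congr 1
    ext p
    simp [Finset.mem_finsuppAntidiag, single_eq_monomial, Finsupp.degree_eq_sum]
  have hli : LinearIndependent K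
      fun e : (Finset.univ : Finset (Fin k)).finsuppAntidiag d =>
        (monomial (e : Fin k →₀ ℕ) (1 : K)) := by
    simpa [Function.comp_def] using
      (basisMonomials (Fin k) K).linearIndependent.comp _ Subtype.val_injective
  rw [hspan, finrank_span_eq_card hli, Fintype.card_coe,
    Finset.card_finsuppAntidiag_nat_eq_choose, Finset.card_univ, Fintype.card_fin]

/-- The form `∑ M i j * X i ^ q * X j` of degree `q + 1`. -/
noncomputable def twistedForm (q : ℕ) :
    Matrix (Fin k) (Fin k) K →ₗ[K] MvPolynomial (Fin k) K where
  toFun M := ∑ i, ∑ j, M i j • (X i ^ q * X j)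
  map_add' M N := by simp [add_smul, Finset.sum_add_distrib]
  map_smul' a M := by simp [mul_smul, Finset.smul_sum]

theorem twistedForm_apply (q : ℕ) (M : Matrix (Fin k) (Fin k) K) :
    twistedForm q M = ∑ i, ∑ j, M i j • (X i ^ q * X j) := rfl

theorem isHomogeneous_twistedForm (q : ℕ) (M : Matrix (Fin k) (Fin k) K) :
    (twistedForm q M).IsHomogeneous (q + 1) := by
  refine IsHomogeneous.sum _ _ _ fun i _ => IsHomogeneous.sum _ _ _ fun j _ => ?_
  exact Submodule.smul_mem (homogeneousSubmodule (Fin k) K (q + 1)) _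
    ((isHomogeneous_X_pow i q).mul (isHomogeneous_X K j))

theorem eval_twistedForm (q : ℕ) (M : Matrix (Fin k) (Fin k) K) (u : Fin k → K) :
    eval u (twistedForm q M) = (fun i => u i ^ q) ⬝ᵥ M *ᵥ u := by
  simp only [twistedForm_apply, map_sum, smul_eval, map_mul, map_pow, eval_X, dotProduct, mulVec,
    Finset.mul_sum]
  exact Finset.sum_congr rfl fun i _ => Finset.sum_congr rfl fun j _ => by ring

/-- For `q ≥ 2` the monomials `X_i^q X_j` are distinct for distinct pairs `(i, j)`, so a twisted
form determines its matrix. -/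
theorem coeff_twistedForm {q : ℕ} (hq : 2 ≤ q) (M : Matrix (Fin k) (Fin k) K) (a b : Fin k) :
    coeff (Finsupp.single a q + Finsupp.single b 1) (twistedForm q M) = M a b := by
  have hmon : ∀ i j : Fin k, (X i ^ q * X j : MvPolynomial (Fin k) K) =
      monomial (Finsupp.single i q + Finsupp.single j 1) 1 := fun i j => by
    rw [X_pow_eq_monomial, X, monomial_mul, one_mul]
  have hinj : ∀ i j : Fin k, Finsupp.single i q + Finsupp.single j 1 =
      Finsupp.single a q + Finsupp.single b 1 ↔ i = a ∧ j = b := by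
    refine fun i j => ⟨fun h => ?_, by rintro ⟨rfl, rfl⟩; rfl⟩
    have hi := DFunLike.congr_fun h i
    have hia : i = a := by
      by_contra hne
      simp only [Finsupp.add_apply, Finsupp.single_apply, if_neg (Ne.symm hne)] at hi
      split_ifs at hi <;> omega
    subst hia
    refine ⟨rfl, ?_⟩
    exact ((Finsupp.single_left_inj one_ne_zero).mp (add_left_cancel h))
  simp only [twistedForm_apply, coeff_sum, coeff_smul, hmon, coeff_monomial, hinj]
  rw [Finset.sum_eq_single a, Finset.sum_eq_single b]
  · simp
  · intro j _ hj; simp [hj]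
  · simp
  · intro i _ hi; simp [hi]
  · simp

theorem twistedForm_injective {q : ℕ} (hq : 2 ≤ q) :
    Function.Injective (twistedForm (K := K) (k := k) q) := by
  intro M N h
  ext a b
  rw [← coeff_twistedForm hq M, h, coeff_twistedForm hq]

theorem eval_single_one_of_isHomogeneous {d : ℕ} {f : MvPolynomial (Fin k) K}
    (hf : f.IsHomogeneous d) (a : Fin k) :
    eval (Pi.single a 1) f = coeff (Finsupp.single a d) f := by
  have key : ∀ e ∈ f.support, e ≠ Finsupp.single a d →
      coeff e f * ∏ i, (Pi.single a 1 : Fin k → K) i ^ e i = 0 := by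
    intro e he hne
    have hdeg : e.degree = d := by
      by_contra h
      exact (mem_support_iff.mp he) (hf.coeff_eq_zero h)
    obtain ⟨i, hi, hei⟩ : ∃ i, i ≠ a ∧ e i ≠ 0 := by
      by_contra! h
      apply hne
      have hea : e = Finsupp.single a (e a) := by
        ext i
        by_cases hi : i = a
        · subst hi; simp
        · rw [h i hi, Finsupp.single_apply, if_neg (Ne.symm hi)]
      rw [hea, Finsupp.degree_single] at hdeg
      rw [hea, hdeg]
    rw [Finset.prod_eq_zero (Finset.mem_univ i), mul_zero]
    simp [hi, hei]
  rw [eval_eq', Finset.sum_eq_single (Finsupp.single a d) key]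
  · rw [Finset.prod_eq_one, mul_one]
    intro i _
    by_cases hi : i = a
    · subst hi; simp
    · simp [Ne.symm hi]
  · intro h
    rw [notMem_support_iff.mp h, zero_mul]

/-- The alternating matrices whose kernel contains `S`. -/
def altForms (S : Set (Fin k → K)) : Submodule K (Matrix (Fin k) (Fin k) K) where
  carrier := {M | (∀ i j, M j i = -M i j) ∧ (∀ i, M i i = 0) ∧ ∀ s ∈ S, M *ᵥ s = 0}
  add_mem' := by
    rintro M N ⟨h₁, h₂, h₃⟩ ⟨h₁', h₂', h₃'⟩
    refine ⟨fun i j => ?_, fun i => ?_, fun s hs => ?_⟩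
    · simp only [Matrix.add_apply, h₁ i j, h₁' i j]; ring
    · simp [h₂, h₂']
    · rw [add_mulVec, h₃ s hs, h₃' s hs, add_zero]
  zero_mem' := by simp
  smul_mem' := by
    rintro a M ⟨h₁, h₂, h₃⟩
    refine ⟨fun i j => ?_, fun i => ?_, fun s hs => ?_⟩
    · simp [h₁ i j]
    · simp [h₂]
    · rw [smul_mulVec, h₃ s hs, smul_zero]

theorem mem_altForms {S : Set (Fin k → K)} {M : Matrix (Fin k) (Fin k) K} :
    M ∈ altForms S ↔ (∀ i j, M j i = -M i j) ∧ (∀ i, M i i = 0) ∧ ∀ s ∈ S, M *ᵥ s = 0 := Iff.rfl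

theorem altForms_anti {S T : Set (Fin k → K)} (h : S ⊆ T) : altForms T ≤ altForms S :=
  fun _ hM => ⟨hM.1, hM.2.1, fun s hs => hM.2.2 s (h hs)⟩

theorem dotProduct_mulVec_swap {S : Set (Fin k → K)} {M : Matrix (Fin k) (Fin k) K}
    (hM : M ∈ altForms S) (u v : Fin k → K) : u ⬝ᵥ M *ᵥ v = -(v ⬝ᵥ M *ᵥ u) := by
  simp only [dotProduct, mulVec, Finset.mul_sum, ← Finset.sum_neg_distrib]
  rw [Finset.sum_comm]
  refine Finset.sum_congr rfl fun i _ => Finset.sum_congr rfl fun j _ => ?_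
  rw [hM.1 i j]; ring

/-- The terms at `(i, j)` and `(j, i)` cancel; in characteristic 2 the diagonal terms vanish only
because the diagonal is required to be zero. -/
theorem dotProduct_mulVec_self {S : Set (Fin k → K)} {M : Matrix (Fin k) (Fin k) K}
    (hM : M ∈ altForms S) (u : Fin k → K) : u ⬝ᵥ M *ᵥ u = 0 := by
  simp only [dotProduct, mulVec, Finset.mul_sum]
  rw [← Finset.sum_product']
  refine Finset.sum_involution (fun p _ => p.swap) ?_ ?_ ?_ ?_
  · rintro ⟨i, j⟩ _
    simp only [Prod.fst_swap, Prod.snd_swap]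
    rw [hM.1 i j]; ring
  · rintro ⟨i, j⟩ _ h heq
    obtain rfl : j = i := congrArg Prod.fst heq
    simp [hM.2.1] at h
  · simp
  · simp

theorem finrank_altForms_empty :
    Module.finrank K (altForms (∅ : Set (Fin k → K))) = k.choose 2 := by
  let e : altForms (∅ : Set (Fin k → K)) ≃ₗ[K] (((i : Fin k) × Fin i) → K) :=
    { toFun := fun M p => M.1 p.1 (Fin.castLE p.1.2.le p.2)
      map_add' := fun M N => rfl
      map_smul' := fun a M => rfl
      invFun := fun v => ⟨fun i j => if h : j < i then v ⟨i, ⟨j, h⟩⟩ else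
          if h : i < j then -v ⟨j, ⟨i, h⟩⟩ else 0, by
        refine ⟨fun i j => ?_, fun i => by simp, by simp⟩
        rcases lt_trichotomy i j with h | h | h
        · simp [h, h.not_gt]
        · simp [h]
        · simp [h, h.not_gt]⟩
      left_inv := by
        rintro ⟨M, hM⟩
        ext i j
        rcases lt_trichotomy i j with h | h | h
        · simpa [h, h.not_gt] using (hM.1 j i).symm
        · subst h; simp [hM.2.1]
        · simp [h]
      right_inv := by
        intro v
        ext ⟨i, j⟩
        have h : Fin.castLE i.2.le j < i := j.2
        simp [h] }
  rw [e.finrank_eq, Module.finrank_fintype_fun_eq_card, Fintype.card_sigma]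
  simp only [Fintype.card_fin]
  rw [Fin.sum_univ_eq_sum_range (fun i => i), Finset.sum_range_id, Nat.choose_two_right]

/-- The matrix of `a ∧ b`, the source of all explicit alternating matrices below. -/
theorem mem_altForms_wedge {S : Set (Fin k → K)} {a b : Fin k → K}
    (hS : ∀ s ∈ S, (b ⬝ᵥ s) • a = (a ⬝ᵥ s) • b) :
    vecMulVec a b - vecMulVec b a ∈ altForms S := by
  refine ⟨fun i j => ?_, fun i => ?_, fun s hs => ?_⟩
  · simp [vecMulVec_apply]; ring
  · simp [vecMulVec_apply]; ring
  · rw [sub_mulVec, vecMulVec_mulVec, vecMulVec_mulVec, sub_eq_zero]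
    simpa using hS s hs

theorem wedge_mulVec (a b s : Fin k → K) :
    (vecMulVec a b - vecMulVec b a) *ᵥ s = (b ⬝ᵥ s) • a - (a ⬝ᵥ s) • b := by
  rw [sub_mulVec, vecMulVec_mulVec, vecMulVec_mulVec]
  simp

/-- Rank-nullity for `M ↦ M t` on alternating matrices: the image is the hyperplane orthogonal to
`t`, since `y ∧ z` sends `t` to `y` whenever `y ⬝ t = 0` and `z ⬝ t = 1`. -/
theorem finrank_altForms_singleton {t : Fin k → K} (ht : t ≠ 0) :
    Module.finrank K (altForms {t}) = (k - 1).choose 2 := by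
  obtain ⟨i₀, hi₀⟩ := Function.ne_iff.mp ht
  let T : altForms (∅ : Set (Fin k → K)) →ₗ[K] (Fin k → K) :=
    { toFun := fun M => M.1 *ᵥ t
      map_add' := fun M N => by simp [add_mulVec]
      map_smul' := fun a M => by simp [smul_mulVec] }
  let D : (Fin k → K) →ₗ[K] K :=
    { toFun := fun y => y ⬝ᵥ t
      map_add' := fun y z => add_dotProduct _ _ _
      map_smul' := fun a y => smul_dotProduct _ _ _ }
  have hz : (Pi.single i₀ (t i₀)⁻¹ : Fin k → K) ⬝ᵥ t = 1 := by
    rw [single_dotProduct, inv_mul_cancel₀ hi₀]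
  have hrange : LinearMap.range T = LinearMap.ker D := by
    ext y
    constructor
    · rintro ⟨M, rfl⟩
      change (M.1 *ᵥ t) ⬝ᵥ t = 0
      rw [dotProduct_comm, dotProduct_mulVec_self M.2]
    · intro hy
      have hy : y ⬝ᵥ t = 0 := hy
      refine ⟨⟨_, mem_altForms_wedge (a := y) (b := Pi.single i₀ (t i₀)⁻¹) (by simp)⟩, ?_⟩
      change (_ - _) *ᵥ t = y
      rw [wedge_mulVec, hz, hy, one_smul, zero_smul, sub_zero]
  have hD : LinearMap.range D = ⊤ := by
    rw [LinearMap.range_eq_top]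
    intro a
    refine ⟨a • Pi.single i₀ (t i₀)⁻¹, ?_⟩
    rw [map_smul]
    change a • ((Pi.single i₀ (t i₀)⁻¹ : Fin k → K) ⬝ᵥ t) = a
    rw [hz, smul_eq_mul, mul_one]
  have hker : Module.finrank K (LinearMap.ker T) = Module.finrank K (altForms {t}) := by
    have h : (LinearMap.ker T).map (Submodule.subtype _) = altForms {t} := by
      ext M
      constructor
      · rintro ⟨N, hN, rfl⟩
        exact ⟨N.2.1, N.2.2.1, by rintro s rfl; exact hN⟩
      · intro hM
        exact ⟨⟨M, altForms_anti (Set.empty_subset _) hM⟩, hM.2.2 t rfl, rfl⟩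
    rw [← h]
    exact (Submodule.equivMapOfInjective _ (Submodule.subtype_injective _) _).finrank_eq
  have h₁ := T.finrank_range_add_finrank_ker
  have h₂ := D.finrank_range_add_finrank_ker
  rw [hD, finrank_top, Module.finrank_self, Module.finrank_fin_fun] at h₂
  rw [hrange, hker, finrank_altForms_empty] at h₁
  obtain ⟨l, rfl⟩ : ∃ l, k = l + 1 := ⟨k - 1, by omega⟩
  rw [show (l + 1).choose 2 = l + l.choose 2 by
    rw [Nat.choose_succ_succ' l 1, Nat.choose_one_right]] at h₁
  simp only [Nat.add_sub_cancel]
  omega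

theorem exists_ne_zero_forall_dotProduct_eq_zero {ι : Type*} [Fintype ι] (h : Fintype.card ι < k)
    (v : ι → Fin k → K) : ∃ b : Fin k → K, b ≠ 0 ∧ ∀ i, v i ⬝ᵥ b = 0 := by
  have hker := (Matrix.mulVecLin (Matrix.of v)).ker_ne_bot_of_finrank_lt (by simpa using h)
  obtain ⟨b, hb, hb0⟩ := (Submodule.ne_bot_iff _).mp hker
  exact ⟨b, hb0, fun i => congrFun hb i⟩

/-- Take `a` orthogonal to `t` but not to `s`, and `b ≠ 0` orthogonal to both, which needs `k > 2`.
Then `a ∧ b` kills `t` and sends `s` to a nonzero multiple of `b`. -/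
theorem not_altForms_le_of_two_lt (hk : 2 < k) {t s : Fin k → K} (ht : t ≠ 0)
    (hs : ∀ a : K, s ≠ a • t) : ¬ altForms {t} ≤ altForms {s} := by
  intro hle
  obtain ⟨i₀, hi₀⟩ := Function.ne_iff.mp ht
  have hi₀ : t i₀ ≠ 0 := hi₀
  obtain ⟨i₁, hi₁⟩ := Function.ne_iff.mp (hs (s i₀ / t i₀))
  have hi₁ : s i₁ ≠ s i₀ / t i₀ * t i₁ := hi₁
  let a : Fin k → K := Pi.single i₁ 1 - Pi.single i₀ (t i₁ / t i₀)
  have hat : a ⬝ᵥ t = 0 := by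
    simp only [a, sub_dotProduct, single_dotProduct]
    field_simp
    ring
  have has : a ⬝ᵥ s ≠ 0 := by
    simp only [a, sub_dotProduct, single_dotProduct, one_mul]
    rw [sub_ne_zero]
    intro h
    apply hi₁
    rw [h]
    ring
  obtain ⟨b, hb0, hb⟩ := exists_ne_zero_forall_dotProduct_eq_zero (by simpa using hk) ![t, s]
  have hbt : b ⬝ᵥ t = 0 := by rw [dotProduct_comm]; exact hb 0
  have hbs : b ⬝ᵥ s = 0 := by rw [dotProduct_comm]; exact hb 1
  have h := (hle (mem_altForms_wedge (a := a) (b := b) (by simp [hat, hbt]))).2.2 s rfl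
  rw [wedge_mulVec, hbs, zero_smul, zero_sub, neg_eq_zero, smul_eq_zero] at h
  exact h.elim has hb0

/-- On `F`-points `X_i^q` and `X_i` agree. Replacing each `X_i^q X_j` in `f` by `X_i X_j` gives a
polynomial of degree `< q` in each variable that vanishes on `F^k`, hence is zero; homogeneity then
separates its parts of degree `q + 1` and `2`. -/
theorem exists_eq_twistedForm {F : Type*} [Field F] [Finite F] [Algebra F K]
    {f : MvPolynomial (Fin k) K} (hf : f.IsHomogeneous (Nat.card F + 1))
    (h0 : ∀ u : Fin k → F, eval (fun i => algebraMap F K (u i)) f = 0) :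
    ∃ M ∈ altForms (∅ : Set (Fin k → K)), f = twistedForm (Nat.card F) M := by
  classical
  have := Fintype.ofFinite F
  set q := Nat.card F with hq
  have hq2 : 2 ≤ q := Finite.one_lt_card
  have hfrob : ∀ a : F, algebraMap F K a ^ q = algebraMap F K a := fun a => by
    rw [← map_pow, hq, Nat.card_eq_fintype_card, FiniteField.pow_card]
  -- The coefficient of `X_a^(q+1)` is the value of `f` at a standard basis vector.
  have hdiag : ∀ a, coeff (Finsupp.single a (q + 1)) f = 0 := by
    intro a
    rw [← eval_single_one_of_isHomogeneous hf, ← h0 (Pi.single a 1)]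
    congr 2
    ext i
    by_cases hi : i = a
    · subst hi; simp
    · simp [hi]
  let M : Matrix (Fin k) (Fin k) K := Matrix.of fun i j =>
    if i = j then 0 else coeff (Finsupp.single i q + Finsupp.single j 1) f
  have hMd : ∀ i, M i i = 0 := fun i => by simp [M]
  let r := f - twistedForm q M
  let s : MvPolynomial (Fin k) K := ∑ i, ∑ j, M i j • (X i * X j)
  have hr : r.IsHomogeneous (q + 1) := hf.sub (isHomogeneous_twistedForm q M)
  have hs : s.IsHomogeneous 2 := by
    refine IsHomogeneous.sum _ _ _ fun i _ => IsHomogeneous.sum _ _ _ fun j _ => ?_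
    exact Submodule.smul_mem (homogeneousSubmodule (Fin k) K 2) _
      ((isHomogeneous_X K i).mul (isHomogeneous_X K j))
  have hrc : ∀ (d : Fin k →₀ ℕ) (a : Fin k), q ≤ d a → coeff d r = 0 := by
    intro d a hda
    by_cases hd : d.degree = q + 1
    · obtain ⟨e, rfl⟩ : ∃ e, d = Finsupp.single a q + e :=
        ⟨d - Finsupp.single a q, (add_tsub_cancel_of_le (by simpa using hda)).symm⟩
      rw [map_add, Finsupp.degree_single, add_right_inj] at hd
      obtain ⟨b, rfl⟩ : ∃ b, Finsupp.single b 1 = e := by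
        rw [← Set.mem_range, Finsupp.range_single_one]
        exact hd
      rw [coeff_sub, coeff_twistedForm hq2]
      by_cases hab : a = b
      · subst hab
        rw [hMd, sub_zero, ← Finsupp.single_add, hdiag]
      · simp [M, hab]
    · exact hr.coeff_eq_zero hd
  have hsc : ∀ (d : Fin k →₀ ℕ) (a : Fin k), q ≤ d a → coeff d s = 0 := by
    intro d a hda
    simp only [s, coeff_sum, coeff_smul]
    refine Finset.sum_eq_zero fun i _ => Finset.sum_eq_zero fun j _ => ?_
    by_cases hij : i = j
    · subst hij; rw [hMd, zero_smul]
    · rw [X, X, monomial_mul, coeff_monomial, if_neg, smul_zero]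
      rintro rfl
      simp only [Finsupp.add_apply, Finsupp.single_apply] at hda
      split_ifs at hda <;> omega
  have hg : r + s = 0 := by
    refine eq_zero_of_eval_zero_at_prod_finset _
      (fun _ => Finset.univ.map ⟨algebraMap F K, (algebraMap F K).injective⟩) ?_ ?_
    · intro i
      rw [Finset.card_map, Finset.card_univ, ← Nat.card_eq_fintype_card, ← hq,
        degreeOf_lt_iff (by omega)]
      intro d hd
      by_contra! h
      exact (mem_support_iff.mp hd) (by rw [coeff_add, hrc d i h, hsc d i h, add_zero])
    · intro x hx
      simp only [Finset.mem_map, Finset.mem_univ, true_and, Function.Embedding.coeFn_mk] at hx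
      choose u hu using hx
      obtain rfl : (fun i => algebraMap F K (u i)) = x := funext hu
      rw [map_add, map_sub, h0, eval_twistedForm]
      simp only [s, hfrob, map_sum, smul_eval, map_mul, eval_X, dotProduct, mulVec, Finset.mul_sum]
      rw [zero_sub, neg_add_eq_zero]
      exact Finset.sum_congr rfl fun i _ => Finset.sum_congr rfl fun j _ => by ring
  have hr0 : r = 0 := by
    by_contra hne
    have hs' : r.IsHomogeneous 2 := by
      rw [eq_neg_of_add_eq_zero_left hg]; exact hs.neg
    have := hr.inj_right hs' hne
    omega
  have hfM : f = twistedForm q M := sub_eq_zero.mp hr0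
  refine ⟨M, ⟨fun i j => ?_, hMd, by simp⟩, hfM⟩
  by_cases hij : i = j
  · subst hij; simp [hMd]
  -- With zero diagonal, the value at `e_i + e_j` is `M i j + M j i`.
  · have h := h0 (Pi.single i 1 + Pi.single j 1)
    have hu : (fun l => algebraMap F K ((Pi.single i 1 + Pi.single j 1 : Fin k → F) l)) =
        Pi.single i 1 + Pi.single j 1 := by
      ext l
      simp only [Pi.add_apply, map_add, Pi.single_apply]
      split_ifs <;> simp
    have hu' : (fun l => (fun l => algebraMap F K ((Pi.single i 1 + Pi.single j 1 : Fin k → F) l)) l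
        ^ q) = Pi.single i 1 + Pi.single j 1 := by
      rw [← hu]; ext l; exact hfrob _
    rw [hfM, eval_twistedForm, hu', hu] at h
    simp only [mulVec_add, dotProduct_add, add_dotProduct, mulVec_single_one,
      single_one_dotProduct, col_apply, hMd] at h
    linear_combination h

end Forms
end RankMetric

namespace RankMetric

open MvPolynomial Matrix

/-! ### The Schur power as a space of evaluated forms. -/

section HilbertSeq

variable {F K : Type*} [Field F] [Field K] [Algebra F K] {n k : ℕ}

theorem add_pow_natCard [Finite F] (x y : K) :
    (x + y) ^ Nat.card F = x ^ Nat.card F + y ^ Nat.card F := by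
  have := Fintype.ofFinite F
  simpa [Nat.card_eq_fintype_card] using map_add (FiniteField.frobeniusAlgHom F K) x y

theorem algebraMap_pow_natCard [Finite F] (a : F) : algebraMap F K a ^ Nat.card F = algebraMap F K a := by
  have := Fintype.ofFinite F
  rw [← map_pow, Nat.card_eq_fintype_card, FiniteField.pow_card]

/-- A matrix annihilating `x ^ q - x` for the columns `x` of `G` does so for all `x` in the system
of `G`. -/
theorem mulVec_pow_sub_of_mem_system [Finite F] {G : Matrix (Fin k) (Fin n) K}
    {M : Matrix (Fin k) (Fin k) K}
    (hM : ∀ j, M *ᵥ (fun i => G i j ^ Nat.card F - G i j) = 0) {u : Fin k → K}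
    (hu : u ∈ system F G) : M *ᵥ (fun i => u i ^ Nat.card F - u i) = 0 := by
  induction hu using Submodule.span_induction with
  | mem x hx =>
    obtain ⟨j, rfl⟩ := hx
    exact hM j
  | zero =>
    have : (fun i => (0 : Fin k → K) i ^ Nat.card F - (0 : Fin k → K) i) = 0 := by
      ext i; simp [Nat.card_pos.ne']
    rw [this, mulVec_zero]
  | add x y _ _ hx hy =>
    have : (fun i => (x + y) i ^ Nat.card F - (x + y) i) =
        (fun i => x i ^ Nat.card F - x i) + fun i => y i ^ Nat.card F - y i := by
      ext i; simp only [Pi.add_apply, add_pow_natCard]; ring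
    rw [this, mulVec_add, hx, hy, add_zero]
  | smul c x _ hx =>
    have : (fun i => (c • x) i ^ Nat.card F - (c • x) i) =
        c • fun i => x i ^ Nat.card F - x i := by
      ext i
      simp only [Pi.smul_apply, Algebra.smul_def, mul_pow, algebraMap_pow_natCard]
      ring
    rw [this, mulVec_smul, hx, smul_zero]

/-- Polarization: `u ↦ u^q` is additive, so vanishing at `u`, `e_i` and `u + e_i` kills the cross
terms, whose sum is the `i`-th entry of `M (u - u^q)` by antisymmetry. Conversely, `M u = M u^q`
turns the value at `u` into the alternating form at `(u^q, u^q)`. -/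
theorem forall_eval_twistedForm_eq_zero_iff [Finite F] {G : Matrix (Fin k) (Fin n) K}
    {σ : Fin k → Fin n}
    (hσ : ∀ l, G.col (σ l) = Pi.single l 1) {M : Matrix (Fin k) (Fin k) K} (hM : M ∈ altForms ∅) :
    (∀ u ∈ system F G, eval u (twistedForm (Nat.card F) M) = 0) ↔
      M ∈ altForms (Set.range fun j i => G i j ^ Nat.card F - G i j) := by
  constructor
  · intro h
    refine ⟨hM.1, hM.2.1, ?_⟩
    rintro _ ⟨j, rfl⟩
    ext i
    have hu : G.col j ∈ system F G := Submodule.subset_span ⟨j, rfl⟩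
    have hi : (Pi.single i 1 : Fin k → K) ∈ system F G := hσ i ▸ Submodule.subset_span ⟨σ i, rfl⟩
    have h₁ := h _ hu
    have h₂ := h _ hi
    have h₃ := h _ (add_mem hu hi)
    have hadd : (fun l => (G.col j + Pi.single i 1 : Fin k → K) l ^ Nat.card F) =
        (fun l => G.col j l ^ Nat.card F) + Pi.single i 1 := by
      ext l
      simp only [Pi.add_apply, add_pow_natCard]
      by_cases hl : l = i
      · subst hl; simp
      · simp [hl, Nat.card_pos.ne']
    have hone : (fun l => (Pi.single i 1 : Fin k → K) l ^ Nat.card F) = Pi.single i 1 := by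
      ext l
      by_cases hl : l = i
      · subst hl; simp
      · simp [hl, Nat.card_pos.ne']
    rw [eval_twistedForm] at h₁ h₂ h₃
    rw [hone] at h₂
    rw [hadd, mulVec_add, add_dotProduct, dotProduct_add, dotProduct_add, h₁, h₂,
      dotProduct_mulVec_swap hM, single_one_dotProduct, single_one_dotProduct] at h₃
    change (M *ᵥ ((fun l => G.col j l ^ Nat.card F) - G.col j)) i = 0
    rw [mulVec_sub, Pi.sub_apply]
    linear_combination -h₃
  · intro h u hu
    have h₁ := mulVec_pow_sub_of_mem_system (fun j => h.2.2 _ ⟨j, rfl⟩) hu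
    change M *ᵥ ((fun i => u i ^ Nat.card F) - u) = 0 at h₁
    rw [mulVec_sub, sub_eq_zero] at h₁
    rw [eval_twistedForm, ← h₁, dotProduct_mulVec_self hM]

theorem forall_eval_col_eq_zero_iff {G : Matrix (Fin k) (Fin n) K} {ι : Type*}
    {H : Matrix (Fin k) ι K} (hH : IsExtendedMatrix F (system F G) H) {d : ℕ} (hd : d ≠ 0)
    {f : MvPolynomial (Fin k) K} (hf : f.IsHomogeneous d) :
    (∀ j, eval (H.col j) f = 0) ↔ ∀ u ∈ system F G, eval u f = 0 := by
  refine ⟨fun h u hu => ?_, fun h j => h _ (hH.1 j).1⟩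
  have hsmul : ∀ (a : K) (x : Fin k → K), eval (a • x) f = a ^ d * eval x f := by
    intro a x
    rw [eval_eq', eval_eq', Finset.mul_sum]
    refine Finset.sum_congr rfl fun e he => ?_
    have hdeg : ∑ i, e i = d := by
      rw [← Finsupp.degree_eq_sum]
      by_contra h
      exact (mem_support_iff.mp he) (hf.coeff_eq_zero h)
    simp only [Pi.smul_apply, smul_eq_mul, mul_pow, Finset.prod_mul_distrib,
      Finset.prod_pow_eq_pow_sum, hdeg]
    ring
  by_cases hu0 : u = 0
  · subst hu0
    rw [← zero_smul K (0 : Fin k → K), hsmul, zero_pow hd, zero_mul]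
  · obtain ⟨j, ⟨a, -, rfl⟩, -⟩ := hH.2 u hu hu0
    rw [algebra_compatible_smul K, hsmul, h, mul_zero]

/-- Rank-nullity for evaluating forms of degree `q + 1` at the columns of `H`: the image is the
Schur power, and `twistedForm` identifies the kernel with the alternating matrices. -/
theorem finrank_hammingCode_pow_add_finrank_altForms [Finite F]
    {G : Matrix (Fin k) (Fin n) K} {σ : Fin k → Fin n} (hσ : ∀ l, G.col (σ l) = Pi.single l 1) {ι : Type*}
    {H : Matrix (Fin k) ι K} (hH : IsExtendedMatrix F (system F G) H) :
    Module.finrank K ↥(hammingCode H ^ (Nat.card F + 1)) +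
      Module.finrank K (altForms (Set.range fun j i => G i j ^ Nat.card F - G i j)) =
        (k + Nat.card F).choose (Nat.card F + 1) := by
  set q := Nat.card F with hq
  let ev : MvPolynomial (Fin k) K →ₐ[K] (ι → K) := aeval H.row
  have hev : ∀ f j, ev f j = eval (H.col j) f := by
    intro f j
    have h : (Pi.evalRingHom (fun _ : ι => K) j).comp (ev : MvPolynomial (Fin k) K →+* (ι → K)) =
        eval (H.col j) := by
      refine ringHom_ext (fun a => ?_) fun i => ?_ <;> simp [ev]
    exact RingHom.congr_fun h f
  have hpow : hammingCode H ^ (q + 1) =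
      (homogeneousSubmodule (Fin k) K (q + 1)).map ev.toLinearMap := by
    rw [← homogeneousSubmodule_one_pow, Submodule.map_pow, homogeneousSubmodule_one_eq_span_X,
      Submodule.map_span, ← Set.range_comp, hammingCode]
    congr 3
    ext1 i
    simp [ev]
  have : Module.Finite K (homogeneousSubmodule (Fin k) K (q + 1)) :=
    Module.Finite.iff_fg.mpr (homogeneousSubmodule_fg _ _ _)
  have hker : (LinearMap.ker (ev.toLinearMap.domRestrict
      (homogeneousSubmodule (Fin k) K (q + 1)))).map (Submodule.subtype _) =
        (altForms (Set.range fun j i => G i j ^ q - G i j)).map (twistedForm q) := by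
    have hmem : ∀ f : MvPolynomial (Fin k) K, f.IsHomogeneous (q + 1) →
        (ev f = 0 ↔ ∀ u ∈ system F G, eval u f = 0) := by
      intro f hf
      rw [← forall_eval_col_eq_zero_iff hH (Nat.succ_ne_zero q) hf, funext_iff]
      simp [hev]
    ext f
    constructor
    · rintro ⟨⟨f, hf⟩, h, rfl⟩
      have hfU := (hmem f hf).mp h
      -- The system contains the standard basis, hence all vectors with entries in `F`.
      obtain ⟨M, hM, rfl⟩ := exists_eq_twistedForm (F := F) hf (by
        intro u
        apply hfU
        have hu : (fun i => algebraMap F K (u i)) = ∑ l, u l • G.col (σ l) := by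
          ext i
          simp [hσ, Finset.sum_apply, Pi.single_apply, Algebra.smul_def]
        rw [hu]
        exact Submodule.sum_mem _ fun l _ =>
          Submodule.smul_mem _ _ (Submodule.subset_span ⟨_, rfl⟩))
      exact ⟨M, (forall_eval_twistedForm_eq_zero_iff hσ hM).mp hfU, rfl⟩
    · rintro ⟨M, hM, rfl⟩
      have hf := isHomogeneous_twistedForm q M
      exact ⟨⟨_, hf⟩, (hmem _ hf).mpr ((forall_eval_twistedForm_eq_zero_iff hσ
        (altForms_anti (Set.empty_subset _) hM)).mpr hM), rfl⟩
  have h := (ev.toLinearMap.domRestrict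
      (homogeneousSubmodule (Fin k) K (q + 1))).finrank_range_add_finrank_ker
  rw [LinearMap.range_domRestrict, ← hpow, finrank_homogeneousSubmodule,
    (Submodule.equivMapOfInjective _ (Submodule.subtype_injective _) _).finrank_eq, hker,
    ← (Submodule.equivMapOfInjective _ (twistedForm_injective Finite.one_lt_card)
      _).finrank_eq] at h
  exact h

end HilbertSeq
end RankMetric

namespace RankMetric

open Matrix

/-! ### Rank constraints on codewords of an MRD code. -/

section MRD

variable {F K : Type*} [Field F] [Field K] [Algebra F K] {n k : ℕ}
  {C : Submodule K (Fin n → K)}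

theorem IsMRD.le_finrank_add_finrank_span (hC : IsMRD F C) {v : Fin n → K} (hv : v ∈ C)
    (hv0 : v ≠ 0) :
    n + 1 ≤ Module.finrank K C + Module.finrank F (Submodule.span F (Set.range v)) := by
  have h : minRankDist F C ≤ Module.finrank F (Submodule.span F (Set.range v)) :=
    Nat.sInf_le ⟨v, hv, 0, C.zero_mem, hv0, by rw [rankDist, sub_zero]⟩
  have := hC.2.2
  omega

/-- A codeword of an MRD code of dimension `k` is zero if its entries lie in the span of at most
`n - k` elements. -/
theorem IsMRD.eq_zero_of_forall_mem_span (hC : IsMRD F C) {v : Fin n → K} (hv : v ∈ C)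
    (s : Finset K) (hs : s.card + Module.finrank K C ≤ n)
    (h : ∀ j, v j ∈ Submodule.span F (s : Set K)) : v = 0 := by
  by_contra hv0
  have h₁ := hC.le_finrank_add_finrank_span hv hv0
  have h₂ : Module.finrank F (Submodule.span F (Set.range v)) ≤
      Module.finrank F (Submodule.span F (s : Set K)) :=
    Submodule.finrank_mono (Submodule.span_le.mpr (by rintro _ ⟨j, rfl⟩; exact h j))
  have h₃ := finrank_span_finset_le_card (R := F) s
  rw [Set.finrank] at h₃
  omega

/-- A vector over `F` has rank at most 1, while `k < n` means minimum distance at least 2. -/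
theorem IsMRD.eq_zero_of_forall_mem_range (hC : IsMRD F C) (hkn : Module.finrank K C < n)
    {v : Fin n → K} (hv : v ∈ C) (h : ∀ j, v j ∈ Set.range (algebraMap F K)) : v = 0 := by
  refine hC.eq_zero_of_forall_mem_span hv {1} (by rw [Finset.card_singleton]; omega) fun j => ?_
  obtain ⟨a, ha⟩ := h j
  rw [Finset.coe_singleton, Submodule.mem_span_singleton]
  exact ⟨a, by rw [← ha, Algebra.algebraMap_eq_smul_one]⟩

theorem IsMRD.eq_zero_of_forall_mem_eq_zero (hC : IsMRD F C) {v : Fin n → K} (hv : v ∈ C)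
    (J : Finset (Fin n)) (hJ : Module.finrank K C ≤ J.card) (h : ∀ j ∈ J, v j = 0) : v = 0 := by
  classical
  refine hC.eq_zero_of_forall_mem_span hv (Jᶜ.image v) ?_ fun j => ?_
  · have h₁ := Finset.card_image_le (s := Jᶜ) (f := v)
    have h₂ := Finset.card_add_card_compl J
    rw [Fintype.card_fin] at h₂
    omega
  · by_cases hj : j ∈ J
    · rw [h j hj]; exact zero_mem _
    · exact Submodule.subset_span (by simpa using ⟨j, hj, rfl⟩)

/-- An MRD code satisfies no linear relation with coefficients in `F`. -/
theorem IsMRD.eq_zero_of_forall_sum_smul_eq_zero (hC : IsMRD F C) (hkn : Module.finrank K C < n)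
    (f : Fin n → F) (hf : ∀ v ∈ C, ∑ j, f j • v j = 0) : f = 0 := by
  classical
  by_contra hf0
  obtain ⟨j₀, hj₀⟩ := Function.ne_iff.mp hf0
  have hj₀ : f j₀ ≠ 0 := hj₀
  have hk : 0 < Module.finrank K C :=
    Nat.pos_of_ne_zero fun h => hC.1 (Submodule.finrank_eq_zero.mp h)
  -- A nonzero codeword can be made to vanish on `k - 1` positions avoiding `j₀`. The relation
  -- expresses its entry at `j₀` through the other `n - k` entries, so its rank is too small.
  obtain ⟨J, hJs, hJ⟩ := Finset.exists_subset_card_eq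
    (s := (Finset.univ : Finset (Fin n)).erase j₀) (n := Module.finrank K C - 1) (by
      rw [Finset.card_erase_of_mem (Finset.mem_univ _), Finset.card_univ, Fintype.card_fin]
      omega)
  let T : C →ₗ[K] (J → K) := LinearMap.funLeft K K Subtype.val ∘ₗ C.subtype
  obtain ⟨⟨v, hv⟩, hvT, hv0⟩ := (Submodule.ne_bot_iff _).mp (T.ker_ne_bot_of_finrank_lt (by
    rw [Module.finrank_fintype_fun_eq_card, Fintype.card_coe]; omega))
  have hvJ : ∀ j ∈ J, v j = 0 := fun j hj => congrFun hvT ⟨j, hj⟩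
  have hj₀J : j₀ ∉ J := fun h => by simpa using hJs h
  apply hv0
  have hmem : ∀ j, j ≠ j₀ →
      v j ∈ Submodule.span F ((((insert j₀ J)ᶜ.image v : Finset K)) : Set K) := by
    intro j hj
    by_cases hjJ : j ∈ J
    · rw [hvJ j hjJ]; exact zero_mem _
    · exact Submodule.subset_span (Finset.mem_coe.mpr (Finset.mem_image_of_mem v (by simp [hj, hjJ])))
  refine Subtype.ext (hC.eq_zero_of_forall_mem_span hv ((insert j₀ J)ᶜ.image v) ?_ fun j => ?_)
  · have h₁ := Finset.card_image_le (s := (insert j₀ J)ᶜ) (f := v)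
    have h₂ := Finset.card_add_card_compl (insert j₀ J)
    rw [Fintype.card_fin, Finset.card_insert_of_notMem hj₀J] at h₂
    omega
  · by_cases hj : j = j₀
    · subst hj
      have h := hf v hv
      change v j ∈ _
      rw [← Finset.add_sum_erase _ _ (Finset.mem_univ j), add_eq_zero_iff_eq_neg] at h
      rw [← inv_smul_smul₀ hj₀ (v j), h]
      exact Submodule.smul_mem _ _ (Submodule.neg_mem _ (Submodule.sum_mem _ fun i hi =>
        Submodule.smul_mem _ _ (hmem i (Finset.ne_of_mem_erase hi))))
    · exact hmem j hj

/-- The first `k` coordinates of an MRD code of dimension `k` form an information set. -/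
theorem IsMRD.exists_systematic (hC : IsMRD F C) (hk : Module.finrank K C = k) (hkn : k ≤ n) :
    ∃ G : Matrix (Fin k) (Fin n) K, IsGeneratorMatrix G C ∧
      ∀ l, G.col (Fin.castLE hkn l) = Pi.single l 1 := by
  let T : C →ₗ[K] (Fin k → K) := LinearMap.funLeft K K (Fin.castLE hkn) ∘ₗ C.subtype
  have hT : Function.Injective T := by
    rw [← LinearMap.ker_eq_bot, LinearMap.ker_eq_bot']
    rintro ⟨v, hv⟩ h
    refine Subtype.ext (hC.eq_zero_of_forall_mem_eq_zero hv
      (Finset.univ.map (Fin.castLEEmb hkn)) (by simp [hk]) ?_)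
    intro j hj
    obtain ⟨l, -, rfl⟩ := Finset.mem_map.mp hj
    exact congrFun h l
  let e := LinearEquiv.ofInjectiveOfFinrankEq T hT (by rw [hk, Module.finrank_fin_fun])
  let b : Module.Basis (Fin k) K C := Module.Basis.ofEquivFun e
  refine ⟨Matrix.of fun i => (b i : Fin n → K), ⟨?_, ?_⟩, fun l => ?_⟩
  · exact b.linearIndependent.map' C.subtype (by simp)
  · have h : Set.range (Matrix.of fun i => (b i : Fin n → K)).row = C.subtype '' Set.range b := by
      rw [← Set.range_comp]; rfl
    rw [h, Submodule.span_image, b.span_eq]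
    simp
  · ext i
    have h : T (b i) = Pi.single i 1 := by
      change e (b i) = _
      simp [b]
    have h' := congrFun h l
    change (b i : Fin n → K) (Fin.castLE hkn l) = _ at h' ⊢
    rw [h', Pi.single_apply, Pi.single_apply]
    simp only [eq_comm]

end MRD
end RankMetric

namespace RankMetric

open Matrix

/-! ### Systematic generator matrices, and small cases where rank one is automatic. -/

section Systematic

variable {K : Type*} [Field K] {n k : ℕ}

theorem IsGeneratorMatrix.eq_sum_of_systematic {C : Submodule K (Fin n → K)}
    {G : Matrix (Fin k) (Fin n) K}
    (hG : IsGeneratorMatrix G C) {σ : Fin k → Fin n} (hσ : ∀ l, G.col (σ l) = Pi.single l 1)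
    {v : Fin n → K} (hv : v ∈ C) (j : Fin n) : v j = ∑ l, v (σ l) * G l j := by
  rw [← hG.2] at hv
  obtain ⟨a, rfl⟩ := (Submodule.mem_span_range_iff_exists_fun K).mp hv
  have hG' : ∀ i l, G i (σ l) = (Pi.single l 1 : Fin k → K) i := fun i l => congrFun (hσ l) i
  simp [Finset.sum_apply, hG', Pi.single_apply]

theorem exists_pow_sub_eq_mul_of_le_one (q : ℕ) {G : Matrix (Fin k) (Fin n) K} (hk : k ≤ 1) :
    ∃ (t : Fin k → K) (γ : Fin n → K), ∀ i j, G i j ^ q - G i j = t i * γ j := by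
  have : Subsingleton (Fin k) := Fin.subsingleton_iff_le_one.mpr hk
  rcases isEmpty_or_nonempty (Fin k) with h | ⟨⟨i₀⟩⟩
  · exact ⟨0, 0, fun i => h.elim i⟩
  · exact ⟨1, fun j => G i₀ j ^ q - G i₀ j, fun i j => by
      rw [Subsingleton.elim i i₀]; simp⟩

/-- Frobenius fixes the identity block, so only the last column of the difference can be nonzero. -/
theorem exists_pow_sub_eq_mul_of_systematic {q : ℕ} (hq : q ≠ 0) {G : Matrix (Fin 2) (Fin 3) K}
    (hσ : ∀ l, G.col (Fin.castLE (by omega) l) = Pi.single l 1) :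
    ∃ (t : Fin 2 → K) (γ : Fin 3 → K), ∀ i j, G i j ^ q - G i j = t i * γ j := by
  have h₀ : ∀ i, G i 0 = (Pi.single 0 1 : Fin 2 → K) i := fun i => congrFun (hσ 0) i
  have h₁ : ∀ i, G i 1 = (Pi.single 1 1 : Fin 2 → K) i := fun i => congrFun (hσ 1) i
  refine ⟨fun i => G i 2 ^ q - G i 2, ![0, 0, 1], fun i j => ?_⟩
  fin_cases i <;> fin_cases j <;> simp [h₀, h₁, hq]

end Systematic

/-! ### Gabidulin codes are the MRD codes with `G^(q) - G` of rank one. -/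

section Gabidulin

variable {F K : Type*} [Field F] [Finite F] [Field K] [Algebra F K] {n k : ℕ}
  {C : Submodule K (Fin n → K)}

variable (F) in
/-- The power `x ↦ x ^ (q ^ e)` of the Frobenius endomorphism over `F`. -/
noncomputable def frobPow (e : ℕ) : K →ₐ[F] K :=
  letI := Fintype.ofFinite F
  FiniteField.frobeniusAlgHom F K ^ e

theorem frobPow_apply (e : ℕ) (x : K) : frobPow F e x = x ^ (Nat.card F ^ e) := by
  have := Fintype.ofFinite F
  rw [frobPow, AlgHom.coe_pow, FiniteField.coe_frobeniusAlgHom, pow_iterate,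
    Nat.card_eq_fintype_card]
  congr!

theorem frobPow_zero (x : K) : frobPow F 0 x = x := by simp [frobPow_apply]

theorem frobPow_one (x : K) : frobPow F 1 x = x ^ Nat.card F := by simp [frobPow_apply]

theorem frobPow_frobPow (a b : ℕ) (x : K) : frobPow F a (frobPow F b x) = frobPow F (a + b) x := by
  simp only [frobPow_apply, ← pow_mul, pow_add, mul_comm]

theorem frobPow_finrank [Finite K] (x : K) : frobPow F (Module.finrank F K) x = x := by
  have := Fintype.ofFinite K
  rw [frobPow_apply, ← Module.natCard_eq_pow_finrank, Nat.card_eq_fintype_card,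
    FiniteField.pow_card]

/-- The polynomial `X^q - X` has at most `q` roots, and `F` already supplies `q`. -/
theorem mem_range_algebraMap_of_pow_natCard_eq {x : K} (hx : x ^ Nat.card F = x) :
    x ∈ Set.range (algebraMap F K) := by
  classical
  have := Fintype.ofFinite F
  have hq : 1 < Nat.card F := Finite.one_lt_card
  have hne := FiniteField.X_pow_card_sub_X_ne_zero K hq
  let s : Finset K := Finset.univ.map ⟨algebraMap F K, (algebraMap F K).injective⟩
  have hs : s ⊆ (Polynomial.X ^ Nat.card F - Polynomial.X : Polynomial K).roots.toFinset := by
    intro y hy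
    obtain ⟨a, -, rfl⟩ := Finset.mem_map.mp hy
    rw [Multiset.mem_toFinset, Polynomial.mem_roots hne]
    simp only [Polynomial.IsRoot, Polynomial.eval_sub, Polynomial.eval_pow, Polynomial.eval_X,
      Function.Embedding.coeFn_mk, algebraMap_pow_natCard, sub_self]
  have heq := Finset.eq_of_subset_of_card_le hs (by
    refine (Multiset.toFinset_card_le _).trans ((Polynomial.card_roots' _).trans ?_)
    rw [FiniteField.X_pow_card_sub_X_natDegree_eq K hq]
    simp [s, Nat.card_eq_fintype_card])
  have hx' : x ∈ s := by
    rw [heq, Multiset.mem_toFinset, Polynomial.mem_roots hne]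
    simp only [Polynomial.IsRoot, Polynomial.eval_sub, Polynomial.eval_pow, Polynomial.eval_X, hx,
      sub_self]
  obtain ⟨a, -, ha⟩ := Finset.mem_map.mp hx'
  exact ⟨a, ha⟩

/-- With `β = α^(q^k')`, Frobenius sends row `i` of `G` to `c i + t i β`, where `c i ∈ C`. The
codeword `c i - G i` is determined by its entries at `σ`, which are `-t i β` since Frobenius fixes
the identity block. So `γ` is `β` minus the codeword agreeing with it at `σ`. -/
theorem IsGabidulin.exists_pow_sub_eq_mul (hGab : IsGabidulin F C) {G : Matrix (Fin k) (Fin n) K}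
    (hG : IsGeneratorMatrix G C) {σ : Fin k → Fin n} (hσ : ∀ l, G.col (σ l) = Pi.single l 1) :
    ∃ (t : Fin k → K) (γ : Fin n → K), ∀ i j, G i j ^ Nat.card F - G i j = t i * γ j := by
  obtain ⟨k', -, α, -, hα⟩ := hGab
  have key : ∀ v ∈ C, ∃ c ∈ C, ∃ t : K, ∀ j,
      v j ^ Nat.card F = c j + t * α j ^ (Nat.card F ^ k') := by
    intro v hv
    rw [← hα.2] at hv
    induction hv using Submodule.span_induction with
    | mem x hx =>
      obtain ⟨i, rfl⟩ := hx
      by_cases hi : (i : ℕ) + 1 < k'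
      · refine ⟨(mooreMatrix F 1 k' α).row ⟨i + 1, hi⟩, ?_, 0, fun j => ?_⟩
        · rw [← hα.2]; exact Submodule.subset_span ⟨_, rfl⟩
        · simp [mooreMatrix, ← pow_mul, pow_succ]
      · refine ⟨0, C.zero_mem, 1, fun j => ?_⟩
        have hi' : Nat.card F ^ k' = Nat.card F ^ (i : ℕ) * Nat.card F := by
          rw [← pow_succ]; congr 1; omega
        simp [mooreMatrix, ← pow_mul, hi']
    | zero => exact ⟨0, C.zero_mem, 0, fun j => by simp [Nat.card_pos.ne']⟩
    | add x y _ _ hx hy =>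
      obtain ⟨c, hc, t, h⟩ := hx
      obtain ⟨c', hc', t', h'⟩ := hy
      refine ⟨c + c', add_mem hc hc', t + t', fun j => ?_⟩
      rw [Pi.add_apply, add_pow_natCard, h, h', Pi.add_apply]; ring
    | smul a x _ hx =>
      obtain ⟨c, hc, t, h⟩ := hx
      refine ⟨a ^ Nat.card F • c, C.smul_mem _ hc, a ^ Nat.card F * t, fun j => ?_⟩
      simp only [Pi.smul_apply, smul_eq_mul, mul_pow, h]; ring
  have hrow : ∀ i, G.row i ∈ C := fun i => hG.2 ▸ Submodule.subset_span ⟨i, rfl⟩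
  have hG' : ∀ i l, G i (σ l) = (Pi.single l 1 : Fin k → K) i := fun i l => congrFun (hσ l) i
  choose c hc t ht using fun i => key _ (hrow i)
  refine ⟨t, fun j => α j ^ (Nat.card F ^ k') -
    ∑ l, α (σ l) ^ (Nat.card F ^ k') * G l j, fun i j => ?_⟩
  have hd := hG.eq_sum_of_systematic hσ (sub_mem (hc i) (hrow i)) j
  have hdl : ∀ l, (c i - G.row i) (σ l) = -(t i * α (σ l) ^ (Nat.card F ^ k')) := by
    intro l
    have h := ht i (σ l)
    have h' : G.row i (σ l) ^ Nat.card F = G.row i (σ l) := by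
      change G i (σ l) ^ _ = G i (σ l)
      rw [hG']
      by_cases hil : i = l
      · subst hil; simp
      · simp [hil, Nat.card_pos.ne']
    rw [Pi.sub_apply]
    linear_combination h' - h
  simp only [hdl, neg_mul, Finset.sum_neg_distrib, mul_assoc, ← Finset.mul_sum] at hd
  have h := ht i j
  rw [Pi.sub_apply] at hd
  change G i j ^ _ = _ at h
  change c i j - G i j = _ at hd
  rw [h]
  linear_combination hd

theorem sum_frobPow_mul_pow {G : Matrix (Fin k) (Fin n) K} {t : Fin k → K} {γ : Fin n → K}
    (h : ∀ i j, G i j ^ Nat.card F - G i j = t i * γ j) (x : Fin k → K)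
    (hx : ∑ i, x i ^ Nat.card F * t i = 0) (j : Fin n) :
    (∑ i, x i * G i j) ^ Nat.card F = ∑ i, x i ^ Nat.card F * G i j := by
  have h' : ∀ i, G i j ^ Nat.card F = G i j + t i * γ j := fun i => by rw [← h i j]; ring
  rw [← frobPow_one, map_sum]
  simp only [map_mul, frobPow_one, h', mul_add, Finset.sum_add_distrib]
  rw [add_eq_left]
  simp only [← mul_assoc, ← Finset.sum_mul, hx, zero_mul]

/-- A trace turns `c` into a nonzero vector `b` over `F` still orthogonal to `t`. Then `bG` is a
Frobenius-fixed codeword, hence has entries in `F` and must vanish. -/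
theorem IsMRD.eq_zero_of_forall_sum_frobPow_mul_eq_zero [Finite K] (hC : IsMRD F C)
    (hkn : Module.finrank K C < n) {G : Matrix (Fin k) (Fin n) K} (hG : IsGeneratorMatrix G C)
    {σ : Fin k → Fin n} (hσ : ∀ l, G.col (σ l) = Pi.single l 1) {t : Fin k → K} {γ : Fin n → K}
    (h : ∀ i j, G i j ^ Nat.card F - G i j = t i * γ j) {c : Fin k → K}
    (hc : ∀ e, ∑ i, frobPow F e (c i) * t i = 0) : c = 0 := by
  by_contra hc0
  obtain ⟨i₀, hi₀⟩ := Function.ne_iff.mp hc0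
  have hi₀ : c i₀ ≠ 0 := hi₀
  obtain ⟨μ, hμ⟩ : ∃ μ, Algebra.trace F K μ ≠ 0 := by
    by_contra! h0
    exact Algebra.trace_ne_zero F K (LinearMap.ext h0)
  -- The scaling makes `b i₀` the trace of `μ`, which is nonzero.
  let b : Fin k → F := fun i => Algebra.trace F K (μ * (c i₀)⁻¹ * c i)
  have hb : ∑ i, algebraMap F K (b i) * t i = 0 := by
    simp only [b, FiniteField.algebraMap_trace_eq_sum_pow, ← frobPow_apply, map_mul,
      Finset.sum_mul]
    rw [Finset.sum_comm]
    refine Finset.sum_eq_zero fun e _ => ?_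
    simp only [mul_assoc, ← Finset.mul_sum, hc, mul_zero]
  have hv : (∑ i, algebraMap F K (b i) • G.row i) ∈ C :=
    Submodule.sum_mem _ fun i _ => C.smul_mem _ (hG.2 ▸ Submodule.subset_span ⟨i, rfl⟩)
  have hvj : ∀ j, (∑ i, algebraMap F K (b i) • G.row i) j = ∑ i, algebraMap F K (b i) * G i j :=
    fun j => by simp [Finset.sum_apply, Algebra.smul_def]
  have hv0 := hC.eq_zero_of_forall_mem_range hkn hv fun j =>
    mem_range_algebraMap_of_pow_natCard_eq (F := F) (by
      rw [hvj, sum_frobPow_mul_pow h _ (by simpa only [algebraMap_pow_natCard] using hb)]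
      simp only [algebraMap_pow_natCard])
  have h0 := congrFun hv0 (σ i₀)
  have hG' : ∀ i, G i (σ i₀) = (Pi.single i₀ 1 : Fin k → K) i := fun i => congrFun (hσ i₀) i
  rw [hvj] at h0
  simp [hG', Pi.single_apply, b, hi₀, hμ] at h0

/-- Applying the Frobenius power `k - 1 - e` to the `e`-th condition makes all of them linear in `z
= c^(q^(k-1))`: `k - 1` equations in `k` unknowns. Frobenius is bijective on the finite field `K`,
so `z` comes from some `c`. -/
theorem exists_ne_zero_sum_frobPow_mul_eq_zero [Finite K] (hk : 0 < k) (t : Fin k → K) :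
    ∃ c : Fin k → K, c ≠ 0 ∧ ∀ e, 1 ≤ e → e < k → ∑ i, frobPow F e (c i) * t i = 0 := by
  obtain ⟨z, hz0, hz⟩ := exists_ne_zero_forall_dotProduct_eq_zero (ι := Fin (k - 1))
    (by simpa using hk) fun s i => frobPow F s (t i)
  have hsurj : Function.Surjective (frobPow F (k - 1) : K →ₐ[F] K) :=
    Finite.surjective_of_injective (frobPow F (k - 1) : K →ₐ[F] K).injective
  choose c hc using fun i => hsurj (z i)
  refine ⟨c, ?_, fun e he hek => ?_⟩
  · rintro rfl
    apply hz0
    ext i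
    rw [← hc]
    simp
  · rw [← map_eq_zero (frobPow F (k - 1 - e) : K →ₐ[F] K)]
    rw [← hz ⟨k - 1 - e, by omega⟩, map_sum]
    refine Finset.sum_congr rfl fun i _ => ?_
    rw [map_mul, frobPow_frobPow, Nat.sub_add_cancel (by omega), hc, mul_comm]

/-- If the Frobenius powers of `c` of index `< k` are dependent and those of index in `[1, k)` are
orthogonal to `t`, then all are. -/
theorem sum_frobPow_mul_eq_zero_of_mem_span [Finite K] {t c : Fin k → K}
    (hct : ∀ e, 1 ≤ e → e < k → ∑ i, frobPow F e (c i) * t i = 0) {r : ℕ} (hr : r < k)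
    (hspan : (fun i => frobPow F r (c i)) ∈
      Submodule.span K (Set.range fun (e : Fin r) i => frobPow F e (c i))) (e : ℕ) :
    ∑ i, frobPow F e (c i) * t i = 0 := by
  obtain ⟨a, ha⟩ := (Submodule.mem_span_range_iff_exists_fun K).mp hspan
  have ha' : ∀ i, frobPow F r (c i) = ∑ l : Fin r, a l * frobPow F l (c i) := fun i => by
    rw [← congrFun ha i]; simp [Finset.sum_apply]
  have hpos : ∀ e, 1 ≤ e → ∑ i, frobPow F e (c i) * t i = 0 := by
    intro e
    induction e using Nat.strong_induction_on with
    | _ e ih =>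
      intro he
      by_cases hek : e < k
      · exact hct e he hek
      -- Shifting the dependency by `e - r` gives a recurrence; `r < k ≤ e` keeps every index on the
      -- right at least 1.
      · have he' : ∀ i, frobPow F e (c i) =
            ∑ l : Fin r, frobPow F (e - r) (a l) * frobPow F (e - r + l) (c i) := fun i => by
          have h := congrArg (frobPow F (e - r)) (ha' i)
          rw [frobPow_frobPow, Nat.sub_add_cancel (by omega), map_sum] at h
          simpa only [map_mul, frobPow_frobPow] using h
        simp only [he', Finset.sum_mul]
        rw [Finset.sum_comm]
        refine Finset.sum_eq_zero fun l _ => ?_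
        have := l.2
        simp only [mul_assoc, ← Finset.mul_sum]
        rw [ih _ (by omega) (by omega), mul_zero]
  rcases Nat.eq_zero_or_pos e with rfl | he
  -- Index 0 is recovered because Frobenius has order dividing the degree of `K / F`.
  · have h := hpos (Module.finrank F K) Module.finrank_pos
    simpa only [frobPow_finrank, frobPow_zero] using h
  · exact hpos e he

/-- Orthogonality to `t` gives `α^(q^e) = c^(q^e) G` for `e < k`, so the Moore rows of `α = cG` are
codewords. They are independent: a dependency among the Frobenius powers of `c` would make all of
them orthogonal to `t`, forcing `c = 0`. -/
theorem IsMRD.isGabidulin_of_pow_sub_eq_mul [Finite K] (hC : IsMRD F C)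
    (hk : Module.finrank K C = k) (hkn : k < n) {G : Matrix (Fin k) (Fin n) K}
    (hG : IsGeneratorMatrix G C) {σ : Fin k → Fin n} (hσ : ∀ l, G.col (σ l) = Pi.single l 1)
    {t : Fin k → K} {γ : Fin n → K} (h : ∀ i j, G i j ^ Nat.card F - G i j = t i * γ j) :
    IsGabidulin F C := by
  have hk0 : 0 < k := hk ▸ Nat.pos_of_ne_zero fun h => hC.1 (Submodule.finrank_eq_zero.mp h)
  obtain ⟨c, hc0, hc⟩ := exists_ne_zero_sum_frobPow_mul_eq_zero (F := F) hk0 t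
  have hli : ∀ r, r ≤ k → LinearIndependent K fun (e : Fin r) i => frobPow F e (c i) := by
    intro r
    induction r with
    | zero => exact fun _ => linearIndependent_empty_type
    | succ r ih =>
      intro hr
      have hsnoc : (fun (e : Fin (r + 1)) i => frobPow F e (c i)) =
          Fin.snoc (fun (e : Fin r) i => frobPow F e (c i)) fun i => frobPow F r (c i) := by
        ext e i
        refine Fin.lastCases ?_ (fun e => ?_) e <;> simp
      rw [hsnoc, linearIndependent_finSnoc]
      refine ⟨ih (by omega), fun hspan => hc0 ?_⟩
      exact hC.eq_zero_of_forall_sum_frobPow_mul_eq_zero (hk ▸ hkn) hG hσ h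
        (sum_frobPow_mul_eq_zero_of_mem_span hc (by omega) hspan)
  let α : Fin n → K := fun j => ∑ i, c i * G i j
  have hα : ∀ e, e < k → ∀ j, α j ^ (Nat.card F ^ e) = ∑ i, frobPow F e (c i) * G i j := by
    intro e
    induction e with
    | zero => intro _ j; simp [α, frobPow_zero]
    | succ e ih =>
      intro he j
      have hfr : ∀ i, frobPow F e (c i) ^ Nat.card F = frobPow F (e + 1) (c i) := fun i => by
        rw [← frobPow_one, frobPow_frobPow, add_comm]
      rw [pow_succ, pow_mul, ih (by omega), sum_frobPow_mul_pow h]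
      · simp only [hfr]
      · simp only [hfr]
        exact hc (e + 1) (by omega) he
  have hG' : ∀ i l, G i (σ l) = (Pi.single l 1 : Fin k → K) i := fun i l => congrFun (hσ l) i
  have hrowli : LinearIndependent K (mooreMatrix F 1 k α).row := by
    refine LinearIndependent.of_comp (LinearMap.funLeft K K σ) ?_
    convert hli k le_rfl using 1
    ext e l
    change α (σ l) ^ (Nat.card F ^ (1 * (e : ℕ))) = _
    rw [one_mul, hα e e.2]
    simp [hG', Pi.single_apply]
  have hrowC : Submodule.span K (Set.range (mooreMatrix F 1 k α).row) = C := by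
    refine Submodule.eq_of_le_of_finrank_eq (Submodule.span_le.mpr ?_) ?_
    · rintro _ ⟨e, rfl⟩
      have he : (mooreMatrix F 1 k α).row e = ∑ i, frobPow F e (c i) • G.row i := by
        ext j
        change α j ^ (Nat.card F ^ (1 * (e : ℕ))) = _
        rw [one_mul, hα e e.2]
        simp [Finset.sum_apply]
      rw [he]
      exact Submodule.sum_mem _ fun i _ => C.smul_mem _ (hG.2 ▸ Submodule.subset_span ⟨i, rfl⟩)
    · rw [finrank_span_eq_card hrowli, hk, Fintype.card_fin]
  refine ⟨k, Nat.gcd_one_left _, α, ?_, hrowli, hrowC⟩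
  rw [Fintype.linearIndependent_iff]
  intro f hf
  refine congrFun (hC.eq_zero_of_forall_sum_smul_eq_zero (hk ▸ hkn) f fun v hv => ?_)
  rw [← hrowC] at hv
  induction hv using Submodule.span_induction with
  | mem x hx =>
    obtain ⟨e, rfl⟩ := hx
    -- Frobenius carries an `F`-relation among the `α j` to every Moore row, hence to all of `C`.
    have h := congrArg (frobPow F e) hf
    rw [map_sum, map_zero] at h
    rw [← h]
    refine Finset.sum_congr rfl fun j _ => ?_
    rw [map_smul, frobPow_apply]
    simp [mooreMatrix]
  | zero => simp
  | add x y _ _ hx hy => simp [smul_add, Finset.sum_add_distrib, hx, hy]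
  | smul a x _ hx =>
    simp only [Pi.smul_apply, smul_comm _ a, ← Finset.smul_sum, hx, smul_zero]

end Gabidulin
end RankMetric

namespace RankMetric

open Matrix

/-! ### From the dimension equality to rank one and back. -/

section Distinguisher

variable {F K : Type*} [Field F] [Finite F] [Field K] [Algebra F K] {n k : ℕ}
  {C : Submodule K (Fin n → K)}

theorem hilbertSeq_add_finrank_altForms {G : Matrix (Fin k) (Fin n) K}
    (hG : IsGeneratorMatrix G C) {σ : Fin k → Fin n} (hσ : ∀ l, G.col (σ l) = Pi.single l 1) :
    hilbertSeq F C (Nat.card F + 1) +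
      Module.finrank K (altForms (Set.range fun j i => G i j ^ Nat.card F - G i j)) =
        (k + Nat.card F).choose (Nat.card F + 1) := by
  rw [← hilbertSeq_eq F C G hG _ (isExtendedMatrix_extendedMatrix F G)]
  exact finrank_hammingCode_pow_add_finrank_altForms hσ (isExtendedMatrix_extendedMatrix F G)

theorem IsMRD.exists_pow_sub_ne_zero (hC : IsMRD F C) (hk : Module.finrank K C = k) (hkn : k < n)
    {G : Matrix (Fin k) (Fin n) K} (hG : IsGeneratorMatrix G C) :
    ∃ j, (fun i => G i j ^ Nat.card F - G i j) ≠ 0 := by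
  have hk0 : 0 < k := hk ▸ Nat.pos_of_ne_zero fun h => hC.1 (Submodule.finrank_eq_zero.mp h)
  by_contra! h
  refine hG.1.ne_zero ⟨0, hk0⟩ (hC.eq_zero_of_forall_mem_range (hk ▸ hkn)
    (hG.2 ▸ Submodule.subset_span ⟨_, rfl⟩) fun j =>
      mem_range_algebraMap_of_pow_natCard_eq (F := F) ?_)
  exact sub_eq_zero.mp (congrFun (h j) ⟨0, hk0⟩)

theorem IsMRD.finrank_altForms_of_pow_sub_eq_mul (hC : IsMRD F C) (hk : Module.finrank K C = k)
    (hkn : k < n) {G : Matrix (Fin k) (Fin n) K} (hG : IsGeneratorMatrix G C) {t : Fin k → K}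
    {γ : Fin n → K} (h : ∀ i j, G i j ^ Nat.card F - G i j = t i * γ j) :
    Module.finrank K (altForms (Set.range fun j i => G i j ^ Nat.card F - G i j)) =
      (k - 1).choose 2 := by
  obtain ⟨j₀, hj₀⟩ := hC.exists_pow_sub_ne_zero hk hkn hG
  have hcol : ∀ j, (fun i => G i j ^ Nat.card F - G i j) = γ j • t := fun j => by
    ext i; simp [h, mul_comm]
  rw [hcol, smul_ne_zero_iff] at hj₀
  suffices heq : altForms (Set.range fun j i => G i j ^ Nat.card F - G i j) = altForms {t} by
    rw [heq, finrank_altForms_singleton hj₀.2]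
  ext M
  simp only [mem_altForms, Set.forall_mem_range, hcol, mulVec_smul, Set.mem_singleton_iff,
    forall_eq]
  refine and_congr_right fun _ => and_congr_right fun _ => ⟨fun hM => ?_, fun hM j => ?_⟩
  · exact (smul_eq_zero.mp (hM j₀)).resolve_left hj₀.1
  · rw [hM, smul_zero]

/-- Killing one nonzero column already cuts out a space of dimension `(k - 1).choose 2`. Equality
means that the other columns impose nothing new, so each is proportional to it. -/
theorem IsMRD.exists_pow_sub_eq_mul_of_finrank_altForms (hC : IsMRD F C)
    (hk : Module.finrank K C = k) (hkn : k < n) (hk2 : 2 < k) {G : Matrix (Fin k) (Fin n) K}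
    (hG : IsGeneratorMatrix G C)
    (h : Module.finrank K (altForms (Set.range fun j i => G i j ^ Nat.card F - G i j)) =
      (k - 1).choose 2) :
    ∃ (t : Fin k → K) (γ : Fin n → K), ∀ i j, G i j ^ Nat.card F - G i j = t i * γ j := by
  obtain ⟨j₀, hj₀⟩ := hC.exists_pow_sub_ne_zero hk hkn hG
  have hle := altForms_anti (Set.singleton_subset_iff.mpr
    (Set.mem_range_self (f := fun j i => G i j ^ Nat.card F - G i j) j₀))
  have heq := Submodule.eq_of_le_of_finrank_eq hle (by rw [h, finrank_altForms_singleton hj₀])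
  have hcol : ∀ j, ∃ a : K, (fun i => G i j ^ Nat.card F - G i j) =
      a • fun i => G i j₀ ^ Nat.card F - G i j₀ := by
    intro j
    by_contra! hne
    refine not_altForms_le_of_two_lt hk2 hj₀ hne ?_
    rw [← heq]
    exact altForms_anti (Set.singleton_subset_iff.mpr (Set.mem_range_self j))
  choose γ hγ using hcol
  exact ⟨_, γ, fun i j => by simpa [mul_comm] using congrFun (hγ j) i⟩

theorem IsMRD.hilbertSeq_eq_of_isGabidulin (hC : IsMRD F C) (hk : Module.finrank K C = k)
    (hkn : k < n) (hGab : IsGabidulin F C) :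
    hilbertSeq F C (Nat.card F + 1) + (k - 1).choose 2 =
      (k + Nat.card F).choose (Nat.card F + 1) := by
  obtain ⟨G, hG, hσ⟩ := hC.exists_systematic hk hkn.le
  obtain ⟨t, γ, h⟩ := hGab.exists_pow_sub_eq_mul hG hσ
  rw [← hilbertSeq_add_finrank_altForms hG hσ,
    hC.finrank_altForms_of_pow_sub_eq_mul hk hkn hG h]

theorem IsMRD.isGabidulin_of_hilbertSeq_eq [Finite K] (hC : IsMRD F C)
    (hk : Module.finrank K C = k) (hkn : k < n) (hk2 : k = 2 → n = 3)
    (h : hilbertSeq F C (Nat.card F + 1) + (k - 1).choose 2 =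
      (k + Nat.card F).choose (Nat.card F + 1)) : IsGabidulin F C := by
  obtain ⟨G, hG, hσ⟩ := hC.exists_systematic hk hkn.le
  have hrank : ∃ (t : Fin k → K) (γ : Fin n → K),
      ∀ i j, G i j ^ Nat.card F - G i j = t i * γ j := by
    rcases lt_trichotomy k 2 with h2 | rfl | h2
    · exact exists_pow_sub_eq_mul_of_le_one _ (by omega)
    · obtain rfl := hk2 rfl
      exact exists_pow_sub_eq_mul_of_systematic Nat.card_pos.ne' hσ
    · refine hC.exists_pow_sub_eq_mul_of_finrank_altForms hk hkn h2 hG ?_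
      rw [← hilbertSeq_add_finrank_altForms hG hσ] at h
      exact (add_left_cancel h).symm
  obtain ⟨t, γ, h⟩ := hrank
  exact hC.isGabidulin_of_pow_sub_eq_mul hk hkn hG hσ h

end Distinguisher
end RankMetric

theorem mainTheorem3 {F K : Type*} [Field F] [Finite F] [Field K] [Finite K] [Algebra F K]
    (q m n k : ℕ) (hq : Nat.card F = q) (hm : Module.finrank F K = m) (hnm : n ≤ m)
    (C : Submodule K (Fin n → K)) (hk : Module.finrank K C = k) (hkn : k < n)
    (hC : RankMetric.IsMRD F C) :
    (RankMetric.IsGabidulin F C →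
      (RankMetric.hilbertSeq F C (q + 1) : ℤ) =
        ((k + q).choose (q + 1) : ℤ) - ((k - 1).choose 2 : ℤ)) ∧
    ((k = 2 → n = 3) →
      (RankMetric.IsGabidulin F C ↔
        (RankMetric.hilbertSeq F C (q + 1) : ℤ) =
          ((k + q).choose (q + 1) : ℤ) - ((k - 1).choose 2 : ℤ))) := by
  subst hq
  have h := hC.hilbertSeq_eq_of_isGabidulin hk hkn
  refine ⟨fun hGab => ?_, fun hk2 => ⟨fun hGab => ?_, fun heq => ?_⟩⟩
  · have := h hGab
    omega
  · have := h hGab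
    omega
  · exact hC.isGabidulin_of_hilbertSeq_eq hk hkn hk2 (by omega)
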